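/- Let $E$ be a finitely generated field extension of $\mathbb{Q}$, let $K/E$ be a field extension of transcendence degree $1$, and let $C$ be a smooth projective curve over $E$ (an integral scheme, smooth and proper over $E$) whose function field is $K$. Fix an algebraic closure $\overline{E}$ of $E$. For $\alpha\in C(\overline{E})$, let $R_\alpha\subset K$ be the local ring of $C$ at $\alpha$, let $z\mapsto z_\alpha$, $R_\alpha\to\overline{E}$, be evaluation at $\alpha$, and let $E(\alpha)\subseteq\overline{E}$ be the residue field of $C$ at $\alpha$. For $f\in K[X]$ let $f_\alpha$ be the fibre at $\alpha$ of the rational map $\mathbb{P}^1_C\dashrightarrow\mathbb{P}^1_C$ with generic fibre $f$: if all coefficients of $f$ lie in $R_\alpha$, then $f_\alpha\in\overline{E}[X]$ is obtained by applying $z\mapsto z_\alpha$ to the coefficients; if some coefficient of $f$ has a pole at $\alpha$, then $f_\alpha$ is the constant map $\infty$. Write $f^k$ for the $k$-th iterate of $f$ under composition. **Proposition.** Let $f,g\in K[X]$ with $\deg(f)\ge 2$, and assume that $f^k\neq g^k$ for every integer $k\ge 1$. Then for each $r>0$ there are at most finitely many $\alpha\in C(\overline{E})$ such that $[E(\alpha):E]\le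 r$ and $f_\alpha^k=g_\alpha^k$ for some integer $k\ge 1$. -/

import Mathlib

open CategoryTheory AlgebraicGeometry Polynomial

universe u v

noncomputable section

namespace Specialization

/-- The `k`-th iterate `f ∘ ⋯ ∘ f` of a polynomial `f`, as a polynomial. -/
def iter {R : Type*} [CommRing R] (f : R[X]) (k : ℕ) : R[X] :=
  (f.comp)^[k] X

section Curve

variable {E : Type u} [Field E] {C : Scheme.{u}}

/-- The constants: the map from the base field `E` to the local ring of `C` at `x`
induced by the structure morphism `π : C ⟶ Spec E`. -/
def constToStalk (π : C ⟶ Spec (.of E)) (x : C) : E →+* C.presheaf.stalk x :=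
  ((Scheme.ΓSpecIso (.of E)).inv ≫ π.appTop ≫ C.presheaf.germ ⊤ x trivial).hom

/-- The structure morphism `Spec Ē ⟶ Spec E` of an algebraic closure `Ē` of `E`. -/
def specAlgClosure (E : Type u) [Field E] :
    Spec (.of (AlgebraicClosure E)) ⟶ Spec (.of E) :=
  Spec.map (CommRingCat.ofHom (algebraMap E (AlgebraicClosure E)))

/-- `C(Ē)`: the set of morphisms `Spec Ē ⟶ C` over `Spec E`. -/
def GeomPoint (π : C ⟶ Spec (.of E)) : Type u :=
  {α : Spec (.of (AlgebraicClosure E)) ⟶ C // α ≫ π = specAlgClosure E}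

namespace GeomPoint

variable {π : C ⟶ Spec (.of E)}

/-- The point of the scheme `C` underlying `α ∈ C(Ē)`. -/
def pt (α : GeomPoint π) : C :=
  α.1 (IsLocalRing.closedPoint (AlgebraicClosure E))

/-- Evaluation at `α`: the map `z ↦ z_α` from the local ring `R` of `C` at `α` to `Ē`. -/
def eval (α : GeomPoint π) : C.presheaf.stalk α.pt →+* AlgebraicClosure E :=
  (Scheme.stalkClosedPointTo (R := .of (AlgebraicClosure E)) α.1).hom

/-- The residue field of `C` at `α`, embedded in `Ē` by means of `α`. -/
def residueEmbedding (α : GeomPoint π) : C.residueField α.pt →+* AlgebraicClosure E :=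
  (C.descResidueField (K := AlgebraicClosure E)
    (Scheme.stalkClosedPointTo (R := .of (AlgebraicClosure E)) α.1)).hom

theorem eval_constToStalk (α : GeomPoint π) (a : E) :
    α.eval (constToStalk π α.pt a) = algebraMap E (AlgebraicClosure E) a := by
  have h1 := Scheme.germ_stalkClosedPointTo_Spec
    (CommRingCat.ofHom (algebraMap E (AlgebraicClosure E)))
  have h2 := Scheme.Hom.germ_stalkMap_assoc π ⊤
    (α.1 (IsLocalRing.closedPoint (AlgebraicClosure E))) trivial
    (Scheme.stalkClosedPointTo (R := .of (AlgebraicClosure E)) α.1)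
  have h3 : ∀ m m' : Spec (.of (AlgebraicClosure E)) ⟶ Spec (.of E), m = m' →
      (Spec (.of E)).presheaf.germ ⊤ _ trivial ≫
        Scheme.stalkClosedPointTo (R := .of (AlgebraicClosure E)) m =
      (Spec (.of E)).presheaf.germ ⊤ _ trivial ≫
        Scheme.stalkClosedPointTo (R := .of (AlgebraicClosure E)) m' := by
    rintro m _ rfl
    rfl
  have h4 : (Spec (.of E)).presheaf.germ ⊤ _ trivial ≫
        Scheme.stalkClosedPointTo (R := .of (AlgebraicClosure E)) (α.1 ≫ π) =
      (Scheme.ΓSpecIso (.of E)).hom ≫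
        CommRingCat.ofHom (algebraMap E (AlgebraicClosure E)) :=
    (h3 _ _ α.2).trans h1
  rw [Scheme.stalkClosedPointTo_comp] at h4
  have h5 := congr((Scheme.ΓSpecIso (.of E)).inv ≫ $(h2.symm.trans h4))
  rw [Iso.inv_hom_id_assoc] at h5
  exact congr(($h5).hom a)

theorem residueEmbedding_residue (α : GeomPoint π) (z : C.presheaf.stalk α.pt) :
    α.residueEmbedding ((C.residue α.pt).hom z) = α.eval z := by
  exact congr($(C.residue_descResidueField (K := AlgebraicClosure E)
    (Scheme.stalkClosedPointTo (R := .of (AlgebraicClosure E)) α.1)).hom z)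

/-- `E(α)`: the residue field of `C` at `α`, as an intermediate field of `Ē / E`. -/
def residueField (α : GeomPoint π) : IntermediateField E (AlgebraicClosure E) :=
  α.residueEmbedding.fieldRange.toIntermediateField fun a =>
    ⟨(C.residue α.pt).hom (constToStalk π α.pt a), by
      rw [residueEmbedding_residue, eval_constToStalk]⟩

variable {K : Type v} [Field K] [IsIntegral C]

/-- The inclusion in `K` of the local ring `R` of `C` at `α`, where `K` is identified with the
function field of `C` by means of `e`. -/
def toK (α : GeomPoint π) (e : C.functionField ≃+* K) : C.presheaf.stalk α.pt →+* K :=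
  (e : C.functionField →+* K).comp (algebraMap (C.presheaf.stalk α.pt) C.functionField)

theorem toK_injective (α : GeomPoint π) (e : C.functionField ≃+* K) :
    Function.Injective (α.toK e) := by
  exact e.injective.comp (IsFractionRing.injective (C.presheaf.stalk α.pt) C.functionField)

open scoped Classical in
/-- The specialization `f_α`, that is, the fibre at `α` of the rational map from `ℙ¹_C` to itself
with generic fibre `f`. If the coefficients of `f` lie in the local ring `R` of `C` at `α`, it is
the polynomial (`some q`) obtained by applying `z ↦ z_α` to them. If some coefficient has a pole
at `α`, then the fibre is the constant map `∞`, which is written `none`. -/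
def specialize (α : GeomPoint π) (e : C.functionField ≃+* K) (f : K[X]) :
    Option (AlgebraicClosure E)[X] :=
  if h : ∃ F : (C.presheaf.stalk α.pt)[X], F.map (α.toK e) = f then
    some (h.choose.map α.eval)
  else none

theorem specialize_map (α : GeomPoint π) (e : C.functionField ≃+* K)
    (F : (C.presheaf.stalk α.pt)[X]) :
    α.specialize e (F.map (α.toK e)) = some (F.map α.eval) := by
  have h : ∃ G : (C.presheaf.stalk α.pt)[X], G.map (α.toK e) = F.map (α.toK e) := ⟨F, rfl⟩
  rw [specialize, dif_pos h, Polynomial.map_injective _ (α.toK_injective e) h.choose_spec]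

/-- The `k`-th iterate (`k ≥ 1`) of `f_α`; the iterates of the constant map `∞` are again the
constant map `∞`. -/
def specializeIter (α : GeomPoint π) (e : C.functionField ≃+* K) (f : K[X]) (k : ℕ) :
    Option (AlgebraicClosure E)[X] :=
  (α.specialize e f).map fun q => iter q k

end GeomPoint

end Curve

end Specialization

end

/-! Let d be the degree of f. After conjugation by a translation f is centered: its coefficient of
degree d - 1 vanishes. Centering gives rigidity in characteristic 0: if g also has degree d and
shares the k-th iterate of f, then g = l f, where l^j = l^d for every j in the support of f and l^(1
+ d + ... + d^(k-1)) = 1 (`eq_C_mul_of_iter_eq`). Conversely, these conditions on l make the k-th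
iterates of f and l f equal (`iter_C_mul`).

Over K, with f centered and g conjugated likewise, let u be the ratio of their coefficients of
degree d. Away from finitely many zeros and poles, f_α^k = g_α^k makes u_α a root of unity. Its
degree over E is at most r and E is finitely generated, so u_α^M = 1 with M depending only on E and
r (`exists_pow_eq_one_of_natDegree_minpoly_le`). Hence, although k is unbounded, the rigidity
conditions amount to the vanishing at α of elements of one finite set: the coefficients of g - u f,
the u^n - 1 with n ≤ M, and the u^j - u^d. If α is neither a zero nor a pole of the nonzero ones,
they vanish already in K, and f^k = g^k, a contradiction (`exists_finset_iter_ne`). Only finitely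
many α are excluded (`GeomPoint.finite_not_isUnit`). -/

namespace Specialization

/-! ### Iterates, translations and scalings of polynomials -/

section Iterate

variable {R S : Type*} [CommRing R] [CommRing S]

theorem iter_one (f : R[X]) : iter f 1 = f := by
  simp [iter]

theorem iter_succ (f : R[X]) (k : ℕ) : iter f (k + 1) = f.comp (iter f k) := by
  rw [iter, Function.iterate_succ_apply', iter]

theorem iter_succ' (f : R[X]) (k : ℕ) : iter f (k + 1) = (iter f k).comp f := by
  induction k with
  | zero => simp [iter]
  | succ k ih => rw [iter_succ, ih, ← comp_assoc, ← iter_succ, ih]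

theorem natDegree_iter [NoZeroDivisors R] [Nontrivial R] (f : R[X]) (k : ℕ) :
    (iter f k).natDegree = f.natDegree ^ k := by
  rw [iter, natDegree_iterate_comp, natDegree_X, mul_one]

/-- The conjugate of `f` by the translation by `c`. -/
noncomputable def translate (c : R) (f : R[X]) : R[X] :=
  f.comp (X + C c) - C c

theorem translate_map (φ : R →+* S) (c : R) (f : R[X]) :
    (translate c f).map φ = translate (φ c) (f.map φ) := by
  simp [translate, Polynomial.map_comp]

theorem translate_injective (c : R) : Function.Injective (translate c) := by
  intro f g h
  have h' := congrArg (fun p => (p + C c).comp (X - C c)) h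
  simpa [translate, comp_assoc] using h'

theorem natDegree_translate [NoZeroDivisors R] [Nontrivial R] (c : R) (f : R[X]) :
    (translate c f).natDegree = f.natDegree := by
  rw [translate, natDegree_sub_C, natDegree_comp, natDegree_X_add_C, mul_one]

theorem iter_translate (c : R) (f : R[X]) (k : ℕ) :
    iter (translate c f) k = translate c (iter f k) := by
  induction k with
  | zero => simp [iter, translate]
  | succ k ih => rw [iter_succ, ih, iter_succ]; simp [translate, comp_assoc]

theorem comp_C_mul_X_of_forall_pow_eq {f : R[X]} {u v : R}
    (h : ∀ j, f.coeff j ≠ 0 → u ^ j = v) : f.comp (C u * X) = C v * f := by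
  ext j
  rw [comp_C_mul_X_coeff, coeff_C_mul]
  by_cases hj : f.coeff j = 0
  · simp [hj]
  · rw [h j hj, mul_comm]

/-- The iterates of `u f`, when multiplication by `u` on the source of `f` amounts to
multiplication by `u ^ d` on its target. -/
theorem iter_C_mul {f : R[X]} {u : R} {d : ℕ} (h : ∀ j, f.coeff j ≠ 0 → u ^ j = u ^ d) (k : ℕ) :
    iter (C u * f) k = C (u ^ ∑ i ∈ Finset.range k, d ^ i) * iter f k := by
  induction k with
  | zero => simp [iter]
  | succ k ih =>
    have h1 : ∀ j, f.coeff j ≠ 0 → (u ^ ∑ i ∈ Finset.range k, d ^ i) ^ j =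
        (u ^ d) ^ ∑ i ∈ Finset.range k, d ^ i := fun j hj => by
      rw [← pow_mul, mul_comm, pow_mul, h j hj]
    have h2 := congrArg (fun p => p.comp (iter f k)) (comp_C_mul_X_of_forall_pow_eq h1)
    rw [comp_assoc, mul_comp, C_comp, X_comp, mul_comp, C_comp] at h2
    rw [iter_succ, iter_succ, ih, mul_comp, C_comp, h2, ← mul_assoc, ← C_mul, ← pow_mul,
      ← pow_succ', geom_sum_succ]

end Iterate

/-! ### Rigidity of centered polynomials with a common iterate -/

section Centered

variable {F : Type*} [Field F]

theorem coeff_pow_natDegree_mul_sub_one {b : F[X]} {n : ℕ} (hb : b.natDegree = n) (hn : 1 ≤ n)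
    {m : ℕ} (hm : 1 ≤ m) :
    (b ^ m).coeff (m * n - 1) = m * b.leadingCoeff ^ (m - 1) * b.coeff (n - 1) := by
  have hb0 : b ≠ 0 := by rintro rfl; simp at hb; omega
  have hl : b.leadingCoeff ≠ 0 := leadingCoeff_ne_zero.mpr hb0
  set c := b * C b.leadingCoeff⁻¹ with hc
  have hcm : c.Monic := monic_mul_leadingCoeff_inv hb0
  have hbc : b = C b.leadingCoeff * c := by
    rw [hc, mul_comm, mul_assoc, ← C_mul, inv_mul_cancel₀ hl, C_1, mul_one]
  have hcn : c.natDegree = n := by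
    rw [hc, natDegree_mul_C (inv_ne_zero hl), hb]
  have h1 := hcm.nextCoeff_pow m
  have hmn : 0 < m * n := Nat.mul_pos hm hn
  rw [nextCoeff_of_natDegree_pos (by rw [natDegree_pow, hcn]; exact hmn),
    nextCoeff_of_natDegree_pos (by rw [hcn]; exact hn), natDegree_pow, hcn] at h1
  obtain ⟨m, rfl⟩ := Nat.exists_eq_add_of_le' hm
  generalize b.leadingCoeff = l at *
  rw [hbc, mul_pow, ← C_pow, coeff_C_mul, coeff_C_mul, h1, nsmul_eq_mul, Nat.add_sub_cancel,
    pow_succ]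
  ring

theorem comp_eq_eraseLead_comp_add (a b : F[X]) :
    a.comp b = a.eraseLead.comp b + C a.leadingCoeff * b ^ a.natDegree := by
  conv_lhs => rw [← eraseLead_add_C_mul_X_pow a, add_comp, C_mul_comp, X_pow_comp]

/-- The lower terms of `a` contribute only in degree at most (m - 1) n, which is below m n - 1
because n ≥ 2. -/
theorem coeff_comp_natDegree_mul_sub_one {a b : F[X]} {m n : ℕ} (ha : a.natDegree = m)
    (hm : 1 ≤ m) (hb : b.natDegree = n) (hn : 2 ≤ n) :
    (a.comp b).coeff (m * n - 1) =
      a.leadingCoeff * (m * b.leadingCoeff ^ (m - 1) * b.coeff (n - 1)) := by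
  rw [comp_eq_eraseLead_comp_add, coeff_add, coeff_C_mul, ha,
    coeff_pow_natDegree_mul_sub_one hb (by omega) hm, coeff_eq_zero_of_natDegree_lt, zero_add]
  have h1 : a.eraseLead.natDegree ≤ m - 1 := ha ▸ eraseLead_natDegree_le a
  rw [natDegree_comp, hb]
  calc _ ≤ (m - 1) * n := Nat.mul_le_mul_right _ h1
    _ < m * n - 1 := by
      obtain ⟨m, rfl⟩ := Nat.exists_eq_add_of_le' hm
      rw [Nat.add_sub_cancel, Nat.add_mul]
      omega

/-- A centered `a` has no term of degree m - 1, so removing its leading term lowers the degree by at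
least 2. -/
theorem natDegree_comp_sub_le {a b : F[X]} {m n : ℕ} (ha : a.natDegree = m)
    (hm : 2 ≤ m) (hc : a.coeff (m - 1) = 0) (hb : b.natDegree = n) :
    (a.comp b - C a.leadingCoeff * b ^ m).natDegree ≤ (m - 2) * n := by
  rw [comp_eq_eraseLead_comp_add, ha, add_sub_cancel_right, natDegree_comp, hb]
  refine Nat.mul_le_mul_right _ (ha ▸ natDegree_eraseLead_le_of_nextCoeff_eq_zero ?_)
  rw [nextCoeff_of_natDegree_pos (by omega), ha, hc]

/-- A decomposition of a polynomial with centered left factor determines the right factor up to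
a scalar. -/
theorem eq_C_mul_of_comp_eq_comp [CharZero F] {a a' b b' : F[X]} {m n : ℕ} (hm : 2 ≤ m)
    (hn : 1 ≤ n) (ha : a.natDegree = m) (ha' : a'.natDegree = m) (hc : a.coeff (m - 1) = 0)
    (hc' : a'.coeff (m - 1) = 0) (hb : b.natDegree = n) (hb' : b'.natDegree = n)
    (h : a.comp b = a'.comp b') : ∃ l : F, b' = C l * b := by
  have hb0 : b ≠ 0 := by rintro rfl; simp at hb; omega
  have ha0' : a' ≠ 0 := by rintro rfl; simp at ha'; omega
  have hb0' : b' ≠ 0 := by rintro rfl; simp at hb'; omega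
  have hl : b.leadingCoeff ≠ 0 := leadingCoeff_ne_zero.mpr hb0
  have hl' : b'.leadingCoeff ≠ 0 := leadingCoeff_ne_zero.mpr hb0'
  have hal' : a'.leadingCoeff ≠ 0 := leadingCoeff_ne_zero.mpr ha0'
  set l := b'.leadingCoeff / b.leadingCoeff with hldef
  refine ⟨l, ?_⟩
  have hl0 : l ≠ 0 := div_ne_zero hl' hl
  have hlead : a.leadingCoeff * b.leadingCoeff ^ m = a'.leadingCoeff * b'.leadingCoeff ^ m := by
    have := congrArg leadingCoeff h
    rwa [leadingCoeff_comp (by omega), leadingCoeff_comp (by omega), ha, ha'] at this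
  have hal : a.leadingCoeff = a'.leadingCoeff * l ^ m := by
    rw [hldef, div_pow, mul_div_assoc', eq_div_iff (pow_ne_zero _ hl), hlead]
  set s := ∑ i ∈ Finset.range m, b' ^ i * (C l * b) ^ (m - 1 - i) with hs
  -- By the choice of l, the leading term of a at b is that of a' at l b, so this is the
  -- factorization of b'^m - (l b)^m. The right side has degree at most (m - 2) n while s has degree
  -- at least (m - 1) n, which forces b' = l b.
  have hkey : C a'.leadingCoeff * (s * (b' - C l * b)) =
      (a.comp b - C a.leadingCoeff * b ^ m) - (a'.comp b' - C a'.leadingCoeff * b' ^ m) := by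
    rw [hs, (Commute.all _ _).geom_sum₂_mul, h, hal, mul_pow, C_mul, C_pow]
    ring
  have hdeg : (C a'.leadingCoeff * (s * (b' - C l * b))).natDegree ≤ (m - 2) * n := by
    rw [hkey]
    exact (natDegree_sub_le_of_le (natDegree_comp_sub_le ha hm hc hb)
      (natDegree_comp_sub_le ha' hm hc' hb')).trans (by simp)
  have hlb : (C l * b).natDegree = n := by rw [natDegree_C_mul hl0, hb]
  -- All m summands have the same top coefficient, so in characteristic 0 nothing cancels.
  have hscoeff : s.coeff ((m - 1) * n) ≠ 0 := by
    have : s.coeff ((m - 1) * n) = m * b'.leadingCoeff ^ (m - 1) := by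
      have hterm : ∀ i ∈ Finset.range m,
          (b' ^ i * (C l * b) ^ (m - 1 - i)).coeff ((m - 1) * n) = b'.leadingCoeff ^ (m - 1) := by
        intro i hi
        rw [Finset.mem_range] at hi
        have hd1 : (b' ^ i).natDegree = i * n := by rw [natDegree_pow, hb']
        have hd2 : ((C l * b) ^ (m - 1 - i)).natDegree = (m - 1 - i) * n := by
          rw [natDegree_pow, hlb]
        have hsum : (m - 1) * n = i * n + (m - 1 - i) * n := by
          rw [← Nat.add_mul]; congr 1; omega
        have hll : (C l * b).leadingCoeff = b'.leadingCoeff := by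
          rw [leadingCoeff_mul, leadingCoeff_C, hldef, div_mul_cancel₀ _ hl]
        rw [hsum, coeff_mul_add_eq_of_natDegree_le hd1.le hd2.le, ← hd1, ← hd2,
          coeff_natDegree, coeff_natDegree, leadingCoeff_pow, leadingCoeff_pow, hll, ← pow_add]
        congr 1; omega
      rw [hs, finsetSum_coeff, Finset.sum_congr rfl hterm]
      simp
    rw [this]
    exact mul_ne_zero (by exact_mod_cast (by omega : m ≠ 0)) (pow_ne_zero _ hl')
  by_contra hne
  have hs0 : s ≠ 0 := by rintro h0; simp [h0] at hscoeff
  have hge := le_natDegree_of_ne_zero hscoeff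
  rw [natDegree_C_mul hal', natDegree_mul hs0 (sub_ne_zero.mpr hne)] at hdeg
  obtain ⟨m, rfl⟩ := Nat.exists_eq_add_of_le' hm
  have : (m + 2 - 1) * n = m * n + n := by rw [show m + 2 - 1 = m + 1 by omega]; ring
  rw [this] at hge
  rw [Nat.add_sub_cancel] at hdeg
  omega

theorem comp_right_cancel {a a' b : F[X]} (hb : b.natDegree ≠ 0) (h : a.comp b = a'.comp b) :
    a = a' := by
  rw [← sub_eq_zero, ← sub_comp, comp_eq_zero_iff] at h
  rcases h with h | ⟨-, h⟩
  · exact sub_eq_zero.mp h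
  · exact absurd (by rw [h, natDegree_C]) hb

theorem coeff_iter_centered {f : F[X]} {d : ℕ} (hd : 2 ≤ d) (hf : f.natDegree = d)
    (hc : f.coeff (d - 1) = 0) {k : ℕ} (hk : 1 ≤ k) : (iter f k).coeff (d ^ k - 1) = 0 := by
  obtain ⟨k, rfl⟩ := Nat.exists_eq_add_of_le' hk
  rw [iter_succ', pow_succ, coeff_comp_natDegree_mul_sub_one (by rw [natDegree_iter, hf])
    (Nat.one_le_pow _ _ (by omega)) hf hd, hc, mul_zero, mul_zero]

/-- The second coefficient of the iterate is a nonzero multiple of that of f. This lets centering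
pass from f to g through the common iterate. -/
theorem coeff_eq_zero_of_iter_centered [CharZero F] {f : F[X]} {d : ℕ} (hd : 2 ≤ d)
    (hf : f.natDegree = d) {k : ℕ} (hk : 1 ≤ k) (hc : (iter f k).coeff (d ^ k - 1) = 0) :
    f.coeff (d - 1) = 0 := by
  obtain ⟨k, rfl⟩ := Nat.exists_eq_add_of_le' hk
  have hpos : 1 ≤ d ^ k := Nat.one_le_pow _ _ (by omega)
  have hn : (iter f k).natDegree = d ^ k := by rw [natDegree_iter, hf]
  rw [iter_succ', pow_succ, coeff_comp_natDegree_mul_sub_one hn hpos hf hd] at hc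
  have h1 : (iter f k).leadingCoeff ≠ 0 := leadingCoeff_ne_zero.mpr fun h => by
    rw [h, natDegree_zero] at hn; omega
  have h2 : f.leadingCoeff ≠ 0 := leadingCoeff_ne_zero.mpr fun h => by
    rw [h, natDegree_zero] at hf; omega
  have h3 : ((d ^ k : ℕ) : F) ≠ 0 := by exact_mod_cast (by omega : d ^ k ≠ 0)
  simpa only [mul_eq_zero, h1, h2, h3, pow_eq_zero_iff', false_and, false_or] using hc

theorem exists_eq_C_mul_of_iter_eq [CharZero F] {f g : F[X]} {d k : ℕ} (hd : 2 ≤ d)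
    (hf : f.natDegree = d) (hg : g.natDegree = d) (hc : f.coeff (d - 1) = 0) (hk : 1 ≤ k)
    (h : iter f k = iter g k) :
    ∃ l : F, g = C l * f := by
  have hc' : g.coeff (d - 1) = 0 := coeff_eq_zero_of_iter_centered hd hg hk
    (h ▸ coeff_iter_centered hd hf hc hk)
  obtain ⟨k, rfl⟩ := Nat.exists_eq_add_of_le' hk
  rcases Nat.eq_zero_or_pos k with rfl | hk0
  · exact ⟨1, by rw [zero_add, iter_one, iter_one] at h; simp [h]⟩
  · rw [iter_succ', iter_succ'] at h
    refine eq_C_mul_of_comp_eq_comp (m := d ^ k) (n := d) ?_ (by omega) (by rw [natDegree_iter, hf])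
      (by rw [natDegree_iter, hg]) (coeff_iter_centered hd hf hc hk0)
      (coeff_iter_centered hd hg hc' hk0) hf hg h
    exact hd.trans (Nat.le_self_pow (by omega) d)

/-- Two polynomials of the same degree with a common iterate, the first of them centered, differ
by a root of unity that is a symmetry of both. -/
theorem eq_C_mul_of_iter_eq [CharZero F] {f g : F[X]} {d k : ℕ} (hd : 2 ≤ d)
    (hf : f.natDegree = d) (hg : g.natDegree = d) (hc : f.coeff (d - 1) = 0) (hk : 1 ≤ k)
    (h : iter f k = iter g k) :
    ∃ l : F, g = C l * f ∧ (∀ j, f.coeff j ≠ 0 → l ^ j = l ^ d) ∧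
      l ^ (∑ i ∈ Finset.range k, d ^ i) = 1 := by
  obtain ⟨l, rfl⟩ := exists_eq_C_mul_of_iter_eq hd hf hg hc hk h
  have hl : l ≠ 0 := by rintro rfl; simp at hg; omega
  have hf0 : f.natDegree ≠ 0 := by omega
  have hfc : f.coeff d ≠ 0 := by
    rw [← hf]
    exact leadingCoeff_ne_zero.mpr fun h0 => hf0 (by rw [h0, natDegree_zero])
  -- Since g = l f commutes with g^k = f^k, one has f^k ∘ (l f) = l f ∘ f^k = (l f^k) ∘ f; cancel f
  -- on the right.
  have hcomm : (iter f k).comp (C l * X) = C l * iter f k := by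
    apply comp_right_cancel hf0
    rw [comp_assoc, mul_comp, C_comp, X_comp, mul_comp, C_comp, ← iter_succ', iter_succ, h]
    rw [← iter_succ', iter_succ, mul_comp, C_comp]
  -- Peeling the outermost f off both sides of `hcomm` and applying uniqueness of right factors
  -- turns the symmetry of f^k into one of f.
  obtain ⟨m, hm⟩ : ∃ m : F, f.comp (C m * X) = C l * f := by
    obtain ⟨k, rfl⟩ := Nat.exists_eq_add_of_le' hk
    have hdk : (iter f k).natDegree = d ^ k := by rw [natDegree_iter, hf]
    have hdk0 : 1 ≤ d ^ k := Nat.one_le_pow _ _ (by omega)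
    have hcl : C l * f.comp (iter f k) = (C l * f).comp (iter f k) := by rw [mul_comp, C_comp]
    rw [iter_succ, comp_assoc, hcl] at hcomm
    obtain ⟨m, hm⟩ := eq_C_mul_of_comp_eq_comp hd hdk0 hg hf (by simp [hc]) hc hdk
      (by rw [natDegree_comp, natDegree_C_mul_X _ hl, mul_one, hdk]) hcomm.symm
    refine ⟨m, ?_⟩
    rw [hm] at hcomm
    apply comp_right_cancel (b := iter f k) (by omega)
    rw [← hcomm, comp_assoc, mul_comp, C_comp, X_comp]
  have hmj : ∀ j, f.coeff j ≠ 0 → m ^ j = l := fun j hj => by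
    have := congrArg (fun p => p.coeff j) hm
    rw [comp_C_mul_X_coeff, coeff_C_mul, mul_comm] at this
    exact mul_right_cancel₀ hj this
  -- Both m^d and m^j equal l, so l^j = m^(d j) = l^d.
  have hsym : ∀ j, f.coeff j ≠ 0 → l ^ j = l ^ d := fun j hj => by
    conv_lhs => rw [← hmj d hfc, ← pow_mul, mul_comm, pow_mul, hmj j hj]
  refine ⟨l, rfl, hsym, ?_⟩
  rw [iter_C_mul hsym] at h
  have hne : iter f k ≠ 0 := fun h0 => by
    have := natDegree_iter f k
    rw [h0, natDegree_zero, hf] at this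
    exact (pow_ne_zero k (by omega : d ≠ 0)) this.symm
  have := mul_right_cancel₀ hne ((one_mul (iter f k)).trans h)
  exact (C_injective (this.symm.trans C_1.symm))

end Centered

/-! ### Roots of unity of bounded degree over a finitely generated field -/

section RootsOfUnity

/-- An algebraic element satisfies no polynomial relation of smaller degree over a purely
transcendental extension. -/
theorem natDegree_minpoly_le_of_algebraicIndependent {k Ω ι : Type*} [Field k] [Field Ω]
    [Algebra k Ω] {x : ι → Ω} (hx : AlgebraicIndependent k x) {z : Ω} (hz : IsAlgebraic k z)
    {q : (MvPolynomial ι k)[X]} (hq : q ≠ 0)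
    (h : q.eval₂ (MvPolynomial.aeval x : MvPolynomial ι k →ₐ[k] Ω).toRingHom z = 0) :
    (minpoly k z).natDegree ≤ q.natDegree := by
  let L := IntermediateField.adjoin k {z}
  have : Algebra.IsAlgebraic k L :=
    IntermediateField.isAlgebraic_adjoin_simple hz.isIntegral
  have hx' : AlgebraicIndependent L x := hx.extendScalars L
  let w : L := IntermediateField.AdjoinSimple.gen k z
  have hw : algebraMap L Ω w = z := IntermediateField.AdjoinSimple.algebraMap_gen k z
  let Q : MvPolynomial ι L := ∑ i ∈ Finset.range (q.natDegree + 1),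
    MvPolynomial.C (w ^ i) * MvPolynomial.map (algebraMap k L) (q.coeff i)
  have hQ : Q = 0 := by
    apply hx'
    rw [map_zero, ← h, eval₂_eq_sum_range, map_sum]
    refine Finset.sum_congr rfl fun i _ => ?_
    rw [map_mul, MvPolynomial.algHom_C, map_pow, hw, MvPolynomial.aeval_map_algebraMap, mul_comm]
    rfl
  -- The x stay independent over k(z), so each monomial gives a separate relation for z over k. A
  -- monomial of the leading coefficient of q gives a nontrivial one.
  obtain ⟨m, hm⟩ := MvPolynomial.ne_zero_iff.mp (leadingCoeff_ne_zero.mpr hq)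
  let P : k[X] := ∑ i ∈ Finset.range (q.natDegree + 1),
    C (MvPolynomial.coeff m (q.coeff i)) * X ^ i
  have hP : aeval z P = 0 := by
    have h1 : aeval w P = MvPolynomial.coeff m Q := by
      simp only [P, Q, map_sum, map_mul, aeval_C, aeval_X_pow, MvPolynomial.coeff_sum,
        MvPolynomial.coeff_C_mul, MvPolynomial.coeff_map]
      exact Finset.sum_congr rfl fun i _ => mul_comm _ _
    rw [← hw, aeval_algebraMap_apply, h1, hQ, MvPolynomial.coeff_zero, map_zero]
  have hP0 : P ≠ 0 := by
    intro h0
    have h1 : P.coeff q.natDegree = MvPolynomial.coeff m (q.coeff q.natDegree) := by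
      simp [P, finsetSum_coeff, coeff_X_pow]
    rw [h0, coeff_zero] at h1
    exact hm h1.symm
  refine (natDegree_le_of_dvd (minpoly.dvd k z hP) hP0).trans ?_
  exact natDegree_sum_le_of_forall_le _ _ fun i hi => (natDegree_C_mul_X_pow_le _ _).trans
    (Nat.lt_succ_iff.mp (Finset.mem_range.mp hi))

open scoped IntermediateField.algebraAdjoinAdjoin in
theorem natDegree_minpoly_le_adjoin {k E Ω ι : Type*} [Field k] [Field E] [Field Ω]
    [Algebra k E] [Algebra E Ω] [Algebra k Ω] [IsScalarTower k E Ω] {x : ι → E}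
    (hx : AlgebraicIndependent k x) {z : Ω} (hz : IsAlgebraic k z) :
    (minpoly k z).natDegree ≤
      (minpoly (IntermediateField.adjoin k (Set.range x)) z).natDegree := by
  set F₀ := IntermediateField.adjoin k (Set.range x)
  let A₀ := Algebra.adjoin k (Set.range x)
  have hzF : IsIntegral F₀ z := (hz.isIntegral).tower_top
  set p := minpoly F₀ z
  let p' := IsLocalization.integerNormalization (nonZeroDivisors A₀) p
  have hp' : p' ≠ 0 :=
    (IsFractionRing.integerNormalization_eq_zero_iff).not.mpr (minpoly.ne_zero hzF)
  have hdeg : p'.natDegree ≤ p.natDegree := natDegree_le_natDegree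
    (degree_mono (IsLocalization.integerNormalization_support _ p))
  have hroot : eval₂ ((algebraMap F₀ Ω).comp (algebraMap A₀ F₀)) z p' = 0 :=
    IsLocalization.integerNormalization_eval₂_eq_zero _ _ p (minpoly.aeval F₀ z)
  have hxΩ : AlgebraicIndependent k (algebraMap E Ω ∘ x) :=
    hx.map' (f := IsScalarTower.toAlgHom k E Ω) (algebraMap E Ω).injective
  let e := hx.aevalEquiv
  let q : (MvPolynomial ι k)[X] := p'.map e.symm.toRingEquiv.toRingHom
  have hq : q ≠ 0 := (Polynomial.map_ne_zero_iff e.symm.injective).mpr hp'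
  refine (natDegree_minpoly_le_of_algebraicIndependent hxΩ hz hq ?_).trans
    (natDegree_map_le.trans hdeg)
  rw [← hroot, eval₂_map]
  congr 1
  ext a
  obtain ⟨b, rfl⟩ := e.surjective a
  change MvPolynomial.aeval (algebraMap E Ω ∘ x) (e.symm (e b)) = algebraMap E Ω (e b : E)
  rw [e.symm_apply_apply, MvPolynomial.aeval_algebraMap_apply]
  exact congrArg _ (hx.algebraMap_aevalEquiv b).symm

/-- E is finite over F₀ = k(t), t a transcendence basis. Adjoining z to F₀ does not lower its degree
over k, and that degree is at most [E(z) : F₀] = [E : F₀] [E(z) : E]. -/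
theorem exists_natDegree_minpoly_le_mul {k E : Type*} (Ω : Type*) [Field k] [Field E] [Field Ω]
    [Algebra k E] [Algebra E Ω] [Algebra k Ω] [IsScalarTower k E Ω]
    (hE : (⊤ : IntermediateField k E).FG) :
    ∃ m : ℕ, ∀ z : Ω, IsAlgebraic k z →
      (minpoly k z).natDegree ≤ m * (minpoly E z).natDegree := by
  have : Algebra.EssFiniteType k E := IntermediateField.fg_top_iff.mp hE
  obtain ⟨s, hs⟩ := hE
  have : Algebra.IsAlgebraic (Algebra.adjoin k (s : Set E)) E := by
    rw [← IntermediateField.isAlgebraic_adjoin_iff_top, hs, Algebra.isAlgebraic_iff_isIntegral]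
    exact Algebra.isIntegral_of_surjective IntermediateField.topEquiv.surjective
  obtain ⟨t, hts, ht⟩ := exists_isTranscendenceBasis_subset (R := k) (s : Set E)
  set F₀ := IntermediateField.adjoin k (Set.range ((↑) : t → E))
  have : Module.Finite F₀ E := by
    have := ht.isAlgebraic_field
    have : Algebra.EssFiniteType F₀ E := .of_comp k _ _
    exact Algebra.finite_of_essFiniteType_of_isAlgebraic
  refine ⟨Module.finrank F₀ E, fun z hz => (natDegree_minpoly_le_adjoin ht.1 hz).trans ?_⟩
  have hzE : IsIntegral E z := hz.isIntegral.tower_top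
  let L := IntermediateField.adjoin E {z}
  have : FiniteDimensional E L := IntermediateField.adjoin.finiteDimensional hzE
  have : Module.Finite F₀ L := Module.Finite.trans E L
  rw [← IntermediateField.adjoin.finrank hzE, Module.finrank_mul_finrank F₀ E L,
    ← IntermediateField.AdjoinSimple.algebraMap_gen E z,
    minpoly.algebraMap_eq (algebraMap L Ω).injective]
  exact minpoly.natDegree_le _

/-- If p^j divides n with j ≥ 1, then p^(j-1) (p - 1) ≤ N, hence p^j ≤ N (N + 1). -/
theorem dvd_factorial_of_totient_le {n N : ℕ} (hn : 0 < n) (h : n.totient ≤ N) :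
    n ∣ (N * (N + 1)).factorial := by
  rw [Nat.dvd_iff_prime_pow_dvd_dvd]
  intro p j hp hj
  rcases Nat.eq_zero_or_pos j with rfl | hj0
  · simp
  have h1 : (p ^ j).totient ≤ N :=
    (Nat.le_of_dvd (Nat.totient_pos.mpr hn) (Nat.totient_dvd_of_dvd hj)).trans h
  rw [Nat.totient_prime_pow hp hj0] at h1
  have hpp := hp.two_le
  have h2 : p ^ (j - 1) ≤ N := le_trans (Nat.le_mul_of_pos_right _ (by omega)) h1
  have h3 : p - 1 ≤ N := le_trans (Nat.le_mul_of_pos_left _ (pow_pos hp.pos _)) h1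
  apply Nat.dvd_factorial (pow_pos hp.pos _)
  obtain ⟨j, rfl⟩ := Nat.exists_eq_add_of_le' hj0
  rw [pow_succ]
  exact Nat.mul_le_mul h2 (by omega)

/-- The roots of unity of bounded degree over a finitely generated field have bounded order. -/
theorem exists_pow_eq_one_of_natDegree_minpoly_le {E Ω : Type*} [Field E] [CharZero E]
    [Field Ω] [Algebra E Ω] (hE : (⊤ : IntermediateField ℚ E).FG) (r : ℕ) :
    ∃ M : ℕ, 0 < M ∧ ∀ z : Ω, IsOfFinOrder z → (minpoly E z).natDegree ≤ r → z ^ M = 1 := by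
  have : CharZero Ω := charZero_of_injective_algebraMap (algebraMap E Ω).injective
  obtain ⟨m, hm⟩ := exists_natDegree_minpoly_le_mul Ω hE
  refine ⟨(m * r * (m * r + 1)).factorial, Nat.factorial_pos _, fun z hz hzr => ?_⟩
  have hn : 0 < orderOf z := orderOf_pos_iff.mpr hz
  have hprim := IsPrimitiveRoot.orderOf z
  have hint : IsIntegral ℚ z := (hprim.isIntegral hn).tower_top
  rw [← orderOf_dvd_iff_pow_eq_one]
  apply dvd_factorial_of_totient_le hn
  rw [← natDegree_cyclotomic (orderOf z) ℚ, cyclotomic_eq_minpoly_rat hprim hn]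
  exact (hm z hint.isAlgebraic).trans (Nat.mul_le_mul_left m hzr)

end RootsOfUnity

/-! ### Finiteness of zeros in transcendence degree one -/

section Specializations

/-- In a field of transcendence degree one, any two elements, the first of them transcendental,
satisfy a polynomial relation that remains nontrivial when the first variable is set to `0`. -/
theorem exists_relation_of_trdeg_eq_one {E K : Type*} [Field E] [Field K] [Algebra E K]
    (hK : Algebra.trdeg E K = 1) {w : K} (hw : Transcendental E w) (x : K) :
    ∃ P : E[X][X], P.eval₂ (aeval w : E[X] →ₐ[E] K).toRingHom x = 0 ∧
      P.map (evalRingHom (0 : E)) ≠ 0 := by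
  have hind : AlgebraicIndependent E ((↑) : ({w} : Set K) → K) :=
    algebraicIndependent_singleton_iff (R := E) (A := K) ⟨w, rfl⟩ |>.mpr hw
  have hbasis : IsTranscendenceBasis E ((↑) : ({w} : Set K) → K) :=
    hind.isTranscendenceBasis_of_trdeg_le (by rw [hK]; exact Cardinal.one_lt_aleph0)
      (by rw [hK]; simp)
  have hw0 : w ≠ 0 := by rintro rfl; exact hw isAlgebraic_zero
  obtain ⟨q, hq0, hq⟩ := hbasis.isAlgebraic.isAlgebraic x
  let φ : E[X] →+* Algebra.adjoin E (Set.range ((↑) : ({w} : Set K) → K)) :=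
    ((aeval w : E[X] →ₐ[E] K).codRestrict _ fun p => by
      rw [Subtype.range_coe]; exact aeval_mem_adjoin_singleton E w).toRingHom
  have hφ : Function.Surjective φ := by
    rintro ⟨y, hy⟩
    rw [Subtype.range_coe, Algebra.adjoin_singleton_eq_range_aeval] at hy
    obtain ⟨p, hp⟩ := hy
    exact ⟨p, Subtype.ext hp⟩
  obtain ⟨P, hP⟩ := Polynomial.map_surjective φ hφ q
  have hP0 : P ≠ 0 := by rintro rfl; exact hq0 (by rw [← hP, Polynomial.map_zero])
  have hPx : P.eval₂ (aeval w : E[X] →ₐ[E] K).toRingHom x = 0 := by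
    rw [← hP, aeval_def, eval₂_map] at hq
    exact hq
  -- Since w ≠ 0, all powers of the first variable can be divided out of the relation.
  obtain ⟨n, P', hP', rfl⟩ := WfDvdMonoid.max_power_factor hP0
    (prime_C_iff.mpr (prime_X (R := E))).irreducible
  refine ⟨P', ?_, fun h => hP' ?_⟩
  · rw [eval₂_mul, eval₂_pow, eval₂_C] at hPx
    refine (mul_eq_zero.mp hPx).resolve_left (pow_ne_zero _ ?_)
    simpa using hw0
  · rw [C_dvd_iff_dvd_coeff]
    intro i
    rw [X_dvd_iff, coeff_zero_eq_eval_zero]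
    simpa using congrArg (fun p => p.coeff i) h

/-- A nonzero element of a finitely generated domain of transcendence degree one vanishes under
only finitely many specializations. -/
theorem finite_algHom_apply_eq_zero {E A K Ω : Type*} [Field E] [CommRing A] [Field K] [Field Ω]
    [Algebra E A] [Algebra E K] [Algebra E Ω] [Algebra.FiniteType E A]
    (hK : Algebra.trdeg E K = 1) {j : A →ₐ[E] K} (hj : Function.Injective j) {w : A}
    (hw : w ≠ 0) : {φ : A →ₐ[E] Ω | φ w = 0}.Finite := by
  by_cases hjw : IsAlgebraic E (j w)
  · have hw' : IsAlgebraic E w := (isAlgebraic_algHom_iff j hj).mp hjw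
    have : IsDomain A := hj.isDomain j
    obtain ⟨p, hp0, hp⟩ :=
      hw'.exists_nonzero_coeff_and_aeval_eq_zero (mem_nonZeroDivisors_of_ne_zero hw)
    refine Set.Finite.subset Set.finite_empty fun φ (hφ : φ w = 0) => hp0 ?_
    have h := congrArg φ hp
    rw [map_zero, ← aeval_algHom_apply, hφ, ← coeff_zero_eq_aeval_zero'] at h
    exact (map_eq_zero _).mp h
  · obtain ⟨s, hs⟩ := Algebra.FiniteType.out (R := E) (A := A)
    -- When φ(w) = 0, each generator x is sent to a root of the nonzero polynomial P(0, ·), leaving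
    -- finitely many choices for φ.
    choose P hP hP0 using fun x : A => exists_relation_of_trdeg_eq_one hK hjw (j x)
    have hinj : Function.Injective (fun (φ : A →ₐ[E] Ω) (x : s) => φ x) := by
      intro φ ψ h
      refine AlgHom.ext_of_adjoin_eq_top hs fun x hx => congrFun h ⟨x, hx⟩
    refine Set.Finite.of_finite_image (f := fun (φ : A →ₐ[E] Ω) (x : s) => φ x)
      (Set.Finite.subset (Set.Finite.pi' fun x : s =>
        ((P x).map (evalRingHom (0 : E))).rootSet_finite Ω) ?_) hinj.injOn
    rintro _ ⟨φ, hφ, rfl⟩ x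
    rw [mem_rootSet]
    refine ⟨hP0 x, ?_⟩
    have h1 : (P (x : A)).eval₂ (aeval w : E[X] →ₐ[E] A).toRingHom x = 0 := by
      apply hj
      rw [map_zero, ← hP x, ← AlgHom.coe_toRingHom, hom_eval₂]
      congr 1
      ext a <;> simp
    have h2 := congrArg φ.toRingHom h1
    rw [hom_eval₂, map_zero] at h2
    rw [aeval_def, eval₂_map, ← h2]
    congr 1
    have hφ' : φ w = 0 := hφ
    ext a <;> simp [hφ']

end Specializations

/-! ### Lifting a common iterate from the fibre to the generic fibre -/

section Algebraic

theorem coeff_translate_centroid {F : Type*} [Field F] [CharZero F] {f : F[X]} {d : ℕ}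
    (hd : 2 ≤ d) (hf : f.natDegree = d) :
    (translate (-f.coeff (d - 1) / (d * f.coeff d)) f).coeff (d - 1) = 0 := by
  have hfd : f.coeff d ≠ 0 := by
    rw [← hf]
    exact leadingCoeff_ne_zero.mpr fun h0 => by rw [h0, natDegree_zero] at hf; omega
  have hd0 : (d : F) ≠ 0 := by exact_mod_cast (by omega : d ≠ 0)
  rw [translate, coeff_sub, coeff_C_of_ne_zero (by omega), sub_zero, ← taylor_apply, taylor_coeff,
    eval_eq_sum_range' (n := 2)
      (lt_of_le_of_lt (natDegree_hasseDeriv_le f (d - 1)) (by omega)),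
    Finset.sum_range_succ, Finset.sum_range_one, hasseDeriv_coeff, hasseDeriv_coeff, zero_add,
    Nat.choose_self, show 1 + (d - 1) = d by omega]
  have : (d.choose (d - 1) : F) = d := by
    rw [Nat.choose_symm (by omega : 1 ≤ d), Nat.choose_one_right]
  rw [this]
  field_simp
  simp

theorem exists_map_eq_of_coeff_mem {R K : Type*} [CommRing R] [CommRing K] {i : R →+* K}
    {p : K[X]} (h : ∀ j, ∃ s, i s = p.coeff j) : ∃ P : R[X], P.map i = p :=
  (mem_lifts p).mp ((lifts_iff_coeff_lifts p).mpr fun j => h j)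

/-- Outside the zeros and poles of finitely many elements of `K`, specializations of bounded
degree of `f` and `g` have no common iterate. -/
theorem exists_finset_iter_ne {E K Ω : Type*} [Field E] [CharZero E] [Field K] [Field Ω]
    [Algebra E K] [Algebra E Ω] (hE : (⊤ : IntermediateField ℚ E).FG) (f g : K[X])
    (hf : 2 ≤ f.natDegree) (hfg : ∀ k : ℕ, 1 ≤ k → iter f k ≠ iter g k) (r : ℕ) :
    ∃ T : Finset K, ∀ (R : Type*) [CommRing R] (i : R →+* K) (ev : R →+* Ω),
      Function.Injective i → (∀ z ∈ T, ∃ s, i s = z ∧ (ev s = 0 → s = 0)) →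
      (∀ s, (minpoly E (ev s)).natDegree ≤ r) →
      ∃ F G : R[X], F.map i = f ∧ G.map i = g ∧
        ∀ k : ℕ, 1 ≤ k → iter (F.map ev) k ≠ iter (G.map ev) k := by
  classical
  have : CharZero K := charZero_of_injective_algebraMap (algebraMap E K).injective
  have : CharZero Ω := charZero_of_injective_algebraMap (algebraMap E Ω).injective
  obtain ⟨M, hM0, hM⟩ := exists_pow_eq_one_of_natDegree_minpoly_le (Ω := Ω) hE r
  obtain ⟨d, hd⟩ : ∃ d, f.natDegree = d := ⟨_, rfl⟩
  rw [hd] at hf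
  obtain ⟨c, hc⟩ : ∃ c, (translate c f).coeff (d - 1) = 0 := ⟨_, coeff_translate_centroid hf hd⟩
  obtain ⟨f', hf'⟩ : ∃ f', translate c f = f' := ⟨_, rfl⟩
  obtain ⟨g', hg'⟩ : ∃ g', translate c g = g' := ⟨_, rfl⟩
  have hfd' : f'.natDegree = d := by rw [← hf', natDegree_translate, hd]
  have hfc' : f'.coeff d ≠ 0 := by
    rw [← hfd']
    exact leadingCoeff_ne_zero.mpr fun h0 => by rw [h0, natDegree_zero] at hfd'; omega
  rw [hf'] at hc
  obtain ⟨u, hu⟩ : ∃ u, g'.coeff d = u * f'.coeff d := ⟨g'.coeff d / f'.coeff d, by field_simp⟩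
  obtain ⟨h, hh⟩ : ∃ h, h = g' - C u * f' := ⟨_, rfl⟩
  -- The coefficients and c, u must be integral at α; nonzero coefficients of f' and g' must survive
  -- to preserve degrees and supports; the rest are the relations to be lifted. Zero is included for
  -- the coefficients outside the supports.
  refine ⟨insert 0 (f'.coeffs ∪ g'.coeffs ∪ h.coeffs ∪ {c, u} ∪
    (Finset.range (M + 1)).image (fun n => u ^ n - 1) ∪
    (Finset.range (d + 1)).image (fun j => u ^ j - u ^ d)), ?_⟩
  intro R _ i ev hi hT hr
  have hcoeff : ∀ (p : K[X]) (j : ℕ), p.coeff j ∈ insert 0 p.coeffs := fun p j => by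
    by_cases hj : p.coeff j = 0
    · rw [hj]; exact Finset.mem_insert_self _ _
    · exact Finset.mem_insert_of_mem (coeff_mem_coeffs hj)
  simp only [Finset.mem_insert, Finset.mem_union, Finset.mem_image, Finset.mem_range] at hT hcoeff
  set T : K → Prop := fun z => ∃ s, i s = z ∧ (ev s = 0 → s = 0)
  have hTf : ∀ j, T (f'.coeff j) := fun j => hT _ (by have := hcoeff f' j; tauto)
  have hTg : ∀ j, T (g'.coeff j) := fun j => hT _ (by have := hcoeff g' j; tauto)
  have hTh : ∀ j, T (h.coeff j) := fun j => hT _ (by have := hcoeff h j; tauto)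
  obtain ⟨c₀, hc₀, -⟩ : T c := hT _ (by simp)
  obtain ⟨u₀, hu₀, -⟩ : T u := hT _ (by simp)
  have hTM : ∀ n ≤ M, T (u ^ n - 1) := fun n hn =>
    hT _ (Or.inr (Or.inl (Or.inr ⟨n, by omega, rfl⟩)))
  have hTd : ∀ j ≤ d, T (u ^ j - u ^ d) := fun j hj =>
    hT _ (Or.inr (Or.inr ⟨j, by omega, rfl⟩))
  have key : ∀ s, T (i s) → ev s = 0 → s = 0 := by
    rintro s ⟨t, ht, h0⟩
    rwa [hi ht] at h0
  obtain ⟨F', hF'⟩ := exists_map_eq_of_coeff_mem fun j => (hTf j).imp fun _ => And.left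
  obtain ⟨G', hG'⟩ := exists_map_eq_of_coeff_mem fun j => (hTg j).imp fun _ => And.left
  have htrans : ∀ (p : K[X]) (P' : R[X]), P'.map i = translate c p →
      (translate (-c₀) P').map i = p := fun p P' hP' => by
    rw [translate_map, hP', map_neg, hc₀]
    simp [translate, comp_assoc]
  refine ⟨translate (-c₀) F', translate (-c₀) G', htrans f F' (hF'.trans hf'.symm),
    htrans g G' (hG'.trans hg'.symm), fun k hk heq => ?_⟩
  rw [translate_map, translate_map, iter_translate, iter_translate] at heq
  replace heq := translate_injective _ heq
  have hdeg : ∀ (p : K[X]) (P : R[X]), P.map i = p → (∀ j, T (p.coeff j)) →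
      (P.map ev).natDegree = p.natDegree := by
    rintro _ P rfl hp
    rw [natDegree_map_eq_of_injective hi]
    by_cases hP : P = 0
    · simp [hP]
    · refine natDegree_map_of_leadingCoeff_ne_zero _ fun h0 => hP (leadingCoeff_eq_zero.mp ?_)
      have := hp P.natDegree
      rw [coeff_map] at this
      exact key _ this h0
  have hFd : (F'.map ev).natDegree = d := by rw [hdeg f' F' hF' hTf, hfd']
  have hGd : (G'.map ev).natDegree = d := by
    have := congrArg natDegree heq
    rw [natDegree_iter, natDegree_iter, hFd] at this
    exact (Nat.pow_left_injective (by omega : k ≠ 0) this).symm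
  have hF'c : ∀ j, i (F'.coeff j) = f'.coeff j := fun j => by rw [← hF', coeff_map]
  have hG'c : ∀ j, i (G'.coeff j) = g'.coeff j := fun j => by rw [← hG', coeff_map]
  have hFc : (F'.map ev).coeff (d - 1) = 0 := by
    have : F'.coeff (d - 1) = 0 := hi (by rw [hF'c, hc, map_zero])
    rw [coeff_map, this, map_zero]
  obtain ⟨l, hl, hsym, hS⟩ := eq_C_mul_of_iter_eq hf hFd hGd hFc hk heq
  have hevF : ∀ j, f'.coeff j ≠ 0 → ev (F'.coeff j) ≠ 0 := fun j hj h0 => hj (by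
    rw [← hF'c, key _ (by rw [hF'c]; exact hTf j) h0, map_zero])
  have hul : ev u₀ = l := by
    have h1 : G'.coeff d = u₀ * F'.coeff d := hi (by rw [map_mul, hG'c, hF'c, hu₀, hu])
    have h2 := congrArg (fun p => p.coeff d) hl
    simp only [coeff_map, coeff_C_mul] at h2
    rw [h1, map_mul] at h2
    exact mul_right_cancel₀ (hevF d hfc') h2
  have hgf : g' = C u * f' := by
    rw [← sub_eq_zero, ← hh]
    ext j
    have h1 : i (G'.coeff j - u₀ * F'.coeff j) = h.coeff j := by
      rw [map_sub, map_mul, hG'c, hF'c, hu₀, hh, coeff_sub, coeff_C_mul]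
    have h2 := congrArg (fun p => p.coeff j) hl
    simp only [coeff_map, coeff_C_mul] at h2
    have h3 := key _ (by rw [h1]; exact hTh j) (by rw [map_sub, map_mul, hul, h2, sub_self])
    rw [← h1, h3, map_zero, coeff_zero]
  have hpow : ∀ n ≤ M, l ^ n = 1 → u ^ n = 1 := fun n hn h1 => by
    have h2 : i (u₀ ^ n - 1) = u ^ n - 1 := by rw [map_sub, map_pow, hu₀, map_one]
    have h3 := key _ (by rw [h2]; exact hTM n hn)
      (by rw [map_sub, map_pow, hul, h1, map_one, sub_self])
    rw [h3, map_zero] at h2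
    exact (sub_eq_zero.mp h2.symm)
  have hlM : l ^ M = 1 := by
    refine hM l (isOfFinOrder_iff_pow_eq_one.mpr ⟨_, ?_, hS⟩) (hul ▸ hr u₀)
    exact Finset.sum_pos (fun _ _ => pow_pos (by omega) _) ⟨0, Finset.mem_range.mpr hk⟩
  have huM : u ^ M = 1 := hpow M le_rfl hlM
  have huS : u ^ (∑ j ∈ Finset.range k, d ^ j) = 1 := by
    -- The exponent grows with k, but modulo M it falls in the range covered by the finite set.
    rw [pow_eq_pow_mod _ huM]
    refine hpow _ (Nat.mod_lt _ hM0).le ?_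
    rw [← pow_eq_pow_mod _ hlM, hS]
  have husym : ∀ j, f'.coeff j ≠ 0 → u ^ j = u ^ d := fun j hj => by
    have h1 := hsym j (by rw [coeff_map]; exact hevF j hj)
    have h2 : i (u₀ ^ j - u₀ ^ d) = u ^ j - u ^ d := by rw [map_sub, map_pow, map_pow, hu₀]
    have h3 := key _ (by rw [h2]; exact hTd j (hfd' ▸ le_natDegree_of_ne_zero hj))
      (by rw [map_sub, map_pow, map_pow, hul, h1, sub_self])
    rw [h3, map_zero] at h2
    exact (sub_eq_zero.mp h2.symm)
  apply hfg k hk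
  apply translate_injective c
  rw [← iter_translate, ← iter_translate, hf', hg', hgf, iter_C_mul husym, huS, C_1, one_mul]

end Algebraic

/-! ### Zeros and poles on the curve, through affine opens -/

section AffineOpen

variable {E : Type u} [Field E] {C : Scheme.{u}}

/-- The constants: the map from the base field `E` to the sections of `C` over `U`. -/
noncomputable def constToSection (π : C ⟶ Spec (.of E)) (U : C.Opens) : E →+* Γ(C, U) :=
  ((Scheme.ΓSpecIso (.of E)).inv ≫ π.appTop ≫
    C.presheaf.map (homOfLE le_top : U ⟶ ⊤).op).hom

theorem germ_constToSection (π : C ⟶ Spec (.of E)) (U : C.Opens) {x : C} (hx : x ∈ U) (a : E) :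
    C.presheaf.germ U x hx (constToSection π U a) = constToStalk π x a := by
  have : (Scheme.ΓSpecIso (.of E)).inv ≫ π.appTop ≫
      C.presheaf.map (homOfLE le_top : U ⟶ ⊤).op ≫ C.presheaf.germ U x hx =
      (Scheme.ΓSpecIso (.of E)).inv ≫ π.appTop ≫ C.presheaf.germ ⊤ x trivial := by
    rw [TopCat.Presheaf.germ_res]
  exact congr(($this).hom a)

theorem finiteType_constToSection (π : C ⟶ Spec (.of E)) [LocallyOfFiniteType π] {U : C.Opens}
    (hU : IsAffineOpen U) : (constToSection π U).FiniteType := by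
  have h1 := π.finiteType_appLE (isAffineOpen_top _) hU le_top
  have h2 : (Scheme.ΓSpecIso (.of E)).inv.hom.FiniteType := RingHom.FiniteType.of_surjective _
    (Scheme.ΓSpecIso (.of E)).symm.commRingCatIsoToRingEquiv.surjective
  exact h1.comp h2

theorem exists_finite_affine_cover (C : Scheme.{u}) [CompactSpace C] :
    ∃ 𝒰 : Set C.Opens, 𝒰.Finite ∧ (∀ U ∈ 𝒰, IsAffineOpen U) ∧ ∀ x : C, ∃ U ∈ 𝒰, x ∈ U := by
  choose U hU hx _ using fun x : C =>
    exists_isAffineOpen_mem_and_subset (TopologicalSpace.Opens.mem_top x)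
  obtain ⟨t, ht⟩ := isCompact_univ.elim_nhds_subcover' (fun x _ => (U x : Set C))
    fun x _ => (U x).isOpen.mem_nhds (hx x)
  refine ⟨(fun x => U x.1) '' (t : Set (Set.univ : Set C)), t.finite_toSet.image _, ?_,
    fun x => ?_⟩
  · rintro _ ⟨x, -, rfl⟩
    exact hU x.1
  · obtain ⟨y, hy, hxy⟩ := Set.mem_iUnion₂.mp (ht (Set.mem_univ x))
    exact ⟨_, ⟨y, hy, rfl⟩, hxy⟩

namespace GeomPoint

variable {π : C ⟶ Spec (.of E)}

/-- Evaluation at `α` of the sections of `C` over a neighbourhood `U` of `α`. -/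
noncomputable def evalSection (α : GeomPoint π) {U : C.Opens} (h : α.pt ∈ U) :
    Γ(C, U) →+* AlgebraicClosure E :=
  α.eval.comp (C.presheaf.germ U α.pt h).hom

theorem evalSection_constToSection (α : GeomPoint π) {U : C.Opens} (h : α.pt ∈ U) (a : E) :
    α.evalSection h (constToSection π U a) = algebraMap E (AlgebraicClosure E) a := by
  rw [← α.eval_constToStalk a, ← germ_constToSection π U h]
  rfl

theorem eq_of_evalSection_eq {α β : GeomPoint π} {U : C.Opens} (hU : IsAffineOpen U)
    (hα : α.pt ∈ U) (hβ : β.pt ∈ U) (h : α.evalSection hα = β.evalSection hβ) : α = β := by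
  have key : ∀ (γ : GeomPoint π) (hγ : γ.pt ∈ U),
      γ.1 = Spec.map (CommRingCat.ofHom (γ.evalSection hγ)) ≫ hU.fromSpec := by
    intro γ hγ
    have h1 := Scheme.Spec_stalkClosedPointTo_fromSpecStalk (R := .of (AlgebraicClosure E)) γ.1
    have h2 := hU.fromSpecStalk_eq_fromSpecStalk hγ
    rw [IsAffineOpen.fromSpecStalk] at h2
    exact (h1.symm.trans congr(Spec.map _ ≫ $(h2.symm))).trans (Spec.map_comp_assoc _ _ _).symm
  apply Subtype.ext
  rw [key α hα, key β hβ, h]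

instance (α : GeomPoint π) : IsLocalHom α.eval :=
  Scheme.isLocalHom_stalkClosedPointTo' α.1

theorem isUnit_of_eval_ne_zero (α : GeomPoint π) {s : C.presheaf.stalk α.pt}
    (h : α.eval s ≠ 0) : IsUnit s :=
  isUnit_of_map_unit α.eval s h.isUnit

/-- E(α) lies in the field generated by the values at α of finitely many algebra generators on an
affine neighbourhood. Finiteness matters because `Module.finrank` of an infinite extension is 0,
which would make a degree bound empty. -/
theorem finiteDimensional_residueField [LocallyOfFiniteType π] (α : GeomPoint π) :
    FiniteDimensional E α.residueField := by
  obtain ⟨U, hU, hα, -⟩ := exists_isAffineOpen_mem_and_subset (TopologicalSpace.Opens.mem_top α.pt)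
  let : Algebra E Γ(C, U) := (constToSection π U).toAlgebra
  obtain ⟨s, hs⟩ : Algebra.FiniteType E Γ(C, U) := finiteType_constToSection π hU
  let φ : Γ(C, U) →ₐ[E] AlgebraicClosure E :=
    { toRingHom := α.evalSection hα
      commutes' := α.evalSection_constToSection hα }
  let L := IntermediateField.adjoin E (φ '' (s : Set Γ(C, U)))
  have : Finite (φ '' (s : Set Γ(C, U))) := (s.finite_toSet.image φ).to_subtype
  have : FiniteDimensional E L := IntermediateField.finiteDimensional_adjoin
    fun x _ => (Algebra.IsAlgebraic.isAlgebraic x).isIntegral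
  have hφL : ∀ a, φ a ∈ L := fun a => by
    have h1 : φ a ∈ (Algebra.adjoin E (s : Set Γ(C, U))).map φ := ⟨a, by rw [hs]; trivial, rfl⟩
    rw [AlgHom.map_adjoin] at h1
    exact IntermediateField.algebra_adjoin_le_adjoin E _ h1
  have hle : α.residueField ≤ L := by
    rintro _ ⟨y, rfl⟩
    obtain ⟨t, rfl⟩ := C.residue_surjective α.pt y
    change α.residueEmbedding ((C.residue α.pt).hom t) ∈ L
    rw [residueEmbedding_residue]
    let : Algebra Γ(C, U) (C.presheaf.stalk α.pt) :=
      C.presheaf.algebra_section_stalk ⟨α.pt, hα⟩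
    have hloc : IsLocalization.AtPrime (C.presheaf.stalk α.pt)
      (hU.primeIdealOf ⟨α.pt, hα⟩).asIdeal := hU.isLocalization_stalk ⟨α.pt, hα⟩
    obtain ⟨⟨a, b⟩, hab⟩ :=
      IsLocalization.surj (hU.primeIdealOf ⟨α.pt, hα⟩).asIdeal.primeCompl t
    have hb := (IsLocalization.map_units (C.presheaf.stalk α.pt) b).map α.eval
    have h1 : α.eval t * φ b = φ a := by
      have := congrArg α.eval hab
      rwa [map_mul] at this
    rw [eq_div_of_mul_eq hb.ne_zero h1]
    exact div_mem (hφL a) (hφL b)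
  exact FiniteDimensional.of_injective (IntermediateField.inclusion hle).toLinearMap
    (IntermediateField.inclusion_injective hle)

theorem natDegree_minpoly_eval_le [LocallyOfFiniteType π] (α : GeomPoint π)
    (s : C.presheaf.stalk α.pt) :
    (minpoly E (α.eval s)).natDegree ≤ Module.finrank E α.residueField := by
  have := α.finiteDimensional_residueField
  have hs : α.eval s ∈ α.residueField := ⟨(C.residue α.pt).hom s, α.residueEmbedding_residue s⟩
  have h := minpoly.natDegree_le (A := E) (⟨α.eval s, hs⟩ : α.residueField)
  rwa [← minpoly.algebraMap_eq (algebraMap α.residueField (AlgebraicClosure E)).injective] at h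

variable {K : Type v} [Field K] [Algebra E K] [IsIntegral C]

/-- A nonzero element of `K` is a unit in the local rings of all but finitely many points in an
affine open. -/
theorem finite_not_isUnit_of_isAffineOpen [LocallyOfFiniteType π]
    (hK : Algebra.trdeg E K = 1) (e : C.functionField ≃+* K)
    (he : ∀ a : E, e (constToStalk π (genericPoint C) a) = algebraMap E K a)
    {U : C.Opens} (hU : IsAffineOpen U) {z : K} (hz : z ≠ 0) :
    {α : GeomPoint π | α.pt ∈ U ∧ ¬ ∃ s, IsUnit s ∧ α.toK e s = z}.Finite := by
  rcases isEmpty_or_nonempty U with hem | hne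
  · exact Set.Finite.subset Set.finite_empty fun α hα => hem.elim ⟨_, hα.1⟩
  let : Algebra E Γ(C, U) := (constToSection π U).toAlgebra
  have : Algebra.FiniteType E Γ(C, U) := finiteType_constToSection π hU
  let j : Γ(C, U) →ₐ[E] K :=
    { toRingHom := (e : C.functionField →+* K).comp (C.germToFunctionField U).hom
      commutes' := fun a => by
        rw [← he a, ← germ_constToSection π U
          (((genericPoint_spec C).mem_open_set_iff U.isOpen).mpr (by simpa using hne))]
        rfl }
  have hj : Function.Injective j :=
    e.injective.comp (C.germToFunctionField_injective U)
  have := functionField_isFractionRing_of_isAffineOpen C U hU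
  obtain ⟨a, b, hb, hab⟩ := IsFractionRing.div_surjective (A := Γ(C, U)) (e.symm z)
  have hjab : j a / j b = z := by
    rw [← e.apply_symm_apply z, ← hab, map_div₀]
    rfl
  have hb0 : b ≠ 0 := nonZeroDivisors.ne_zero hb
  have ha0 : a ≠ 0 := by
    rintro rfl
    rw [map_zero, zero_div] at hjab
    exact hz hjab.symm
  have hjg : ∀ (α : GeomPoint π) (h : α.pt ∈ U) (y : Γ(C, U)),
      α.toK e (C.presheaf.germ U α.pt h y) = j y := fun α h y =>
    congrArg e (Scheme.algebraMap_germ_eq_germToFunctionField C h y)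
  -- With z = a / b, every point of U where z is not a unit is a zero of a b.
  have hab0 : a * b ≠ 0 := mul_ne_zero ha0 hb0
  let Φ : {α : GeomPoint π // α.pt ∈ U} → (Γ(C, U) →ₐ[E] AlgebraicClosure E) := fun α =>
    { toRingHom := α.1.evalSection α.2
      commutes' := α.1.evalSection_constToSection α.2 }
  have hΦ : Function.Injective Φ := fun α β h =>
    Subtype.ext (eq_of_evalSection_eq hU α.2 β.2 (congrArg AlgHom.toRingHom h))
  have hfin := ((finite_algHom_apply_eq_zero (Ω := AlgebraicClosure E) hK hj hab0).preimage
    hΦ.injOn).image Subtype.val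
  refine hfin.subset ?_
  rintro α ⟨hα, hnot⟩
  refine ⟨⟨α, hα⟩, ?_, rfl⟩
  by_contra hne0
  have hne0' : α.evalSection hα a * α.evalSection hα b ≠ 0 := by
    rw [← map_mul]; exact hne0
  obtain ⟨sa, hsa⟩ := α.isUnit_of_eval_ne_zero (left_ne_zero_of_mul hne0')
  obtain ⟨sb, hsb⟩ := α.isUnit_of_eval_ne_zero (right_ne_zero_of_mul hne0')
  refine hnot ⟨sa * sb⁻¹, (sa * sb⁻¹).isUnit, ?_⟩
  have h1 : α.toK e sa = j a := by rw [hsa]; exact hjg α hα a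
  have h2 : α.toK e sb = j b := by rw [hsb]; exact hjg α hα b
  rw [map_mul, h1, ← hjab, div_eq_mul_inv, ← h2]
  congr 1
  exact eq_inv_of_mul_eq_one_left (by rw [← map_mul, Units.inv_mul, map_one])

/-- A nonzero element of `K` is a unit in the local rings of all but finitely many points. -/
theorem finite_not_isUnit [LocallyOfFiniteType π] [CompactSpace C]
    (hK : Algebra.trdeg E K = 1) (e : C.functionField ≃+* K)
    (he : ∀ a : E, e (constToStalk π (genericPoint C) a) = algebraMap E K a)
    {z : K} (hz : z ≠ 0) :
    {α : GeomPoint π | ¬ ∃ s, IsUnit s ∧ α.toK e s = z}.Finite := by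
  obtain ⟨𝒰, hfin, haff, hcov⟩ := exists_finite_affine_cover C
  refine (hfin.biUnion fun U hU =>
    finite_not_isUnit_of_isAffineOpen (π := π) hK e he (haff U hU) hz).subset fun α hα => ?_
  obtain ⟨U, hU, hx⟩ := hcov α.pt
  exact Set.mem_biUnion hU ⟨hx, hα⟩

end GeomPoint

end AffineOpen

end Specialization

/-! ### The proposition -/

theorem mainTheorem7 {E : Type u} [Field E] [CharZero E]
    (hE : (⊤ : IntermediateField ℚ E).FG)
    {K : Type v} [Field K] [Algebra E K] (hK : Algebra.trdeg E K = 1)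
    (C : AlgebraicGeometry.Scheme.{u}) [AlgebraicGeometry.IsIntegral C]
    (π : C ⟶ AlgebraicGeometry.Spec (.of E))
    [AlgebraicGeometry.Smooth π] [AlgebraicGeometry.IsProper π]
    (e : C.functionField ≃+* K)
    (he : ∀ a : E, e (Specialization.constToStalk π (genericPoint C) a) = algebraMap E K a)
    (f g : Polynomial K) (hf : 2 ≤ f.natDegree)
    (hfg : ∀ k : ℕ, 1 ≤ k → Specialization.iter f k ≠ Specialization.iter g k)
    (r : ℕ) :
    {α : Specialization.GeomPoint π | Module.finrank E α.residueField ≤ r ∧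
      ∃ k : ℕ, 1 ≤ k ∧ α.specializeIter e f k = α.specializeIter e g k}.Finite := by
  open Specialization in
  have : CompactSpace C := QuasiCompact.compactSpace_of_compactSpace π
  obtain ⟨T, hT⟩ := exists_finset_iter_ne (Ω := AlgebraicClosure E) hE f g hf hfg r
  -- The element 0 of T is a unit nowhere and must not exclude any point; it meets the condition on
  -- T trivially.
  refine (T.finite_toSet.biUnion (t := fun z => {α : GeomPoint π | z ≠ 0 ∧
    ¬ ∃ s, IsUnit s ∧ α.toK e s = z}) fun z _ => ?_).subset ?_
  · by_cases hz : z = 0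
    · simp [hz]
    · exact (GeomPoint.finite_not_isUnit hK e he hz).subset fun α hα => hα.2
  · rintro α ⟨hr, k, hk, heq⟩
    by_contra hα
    simp only [Set.mem_iUnion, Set.mem_ofPred_eq, not_exists, not_and] at hα
    obtain ⟨F, G, rfl, rfl, hne⟩ := hT _ (α.toK e) α.eval (α.toK_injective e)
      (fun z hz => by
        by_cases hz0 : z = 0
        · exact ⟨0, by rw [map_zero, hz0], fun _ => rfl⟩
        · obtain ⟨s, hs, hsz⟩ : ∃ s, IsUnit s ∧ α.toK e s = z := by
            simpa using hα z hz hz0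
          exact ⟨s, hsz, fun h0 => absurd h0 (hs.map α.eval).ne_zero⟩)
      (fun s => (α.natDegree_minpoly_eval_le s).trans hr)
    rw [GeomPoint.specializeIter, GeomPoint.specializeIter, GeomPoint.specialize_map,
      GeomPoint.specialize_map] at heq
    exact hne k hk (Option.some_injective _ heq)
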